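/- Let $G$ be a group (for instance a finite group or a compact Lie group) and let $U$ be a unitary representation of $G$ on a finite-dimensional complex Hilbert space $\mathcal H$. Then $\mathcal H$ admits a decomposition into irreps, that is, a unitary identification $$\mathcal H\cong\bigoplus_\mu \mathcal M_\mu\otimes\mathcal N_\mu,\qquad U(g)\cong\bigoplus_\mu U_\mu(g)\otimes I_{\mathcal N_\mu}\quad(g\in G),$$ with finitely many labels $\mu$, where the $U_\mu$ are pairwise inequivalent irreducible unitary representations of $G$ on $\mathcal M_\mu$ and the $\mathcal N_\mu$ are finite-dimensional Hilbert spaces (multiplicity spaces). Fix any such decomposition, and let $\Pi_\mu$ be the projection of $\mathcal H$ onto $\mathcal M_\mu\otimes\mathcal N_\mu$. For unit vectors $\psi_1,\psi_2\in\mathcal H$ let $$F_i^{(\mu)}=\mathrm{tr}_{\mathcal N_\mu}\bigl(\Pi_\mu|\psi_i\rangle\langle\psi_i|\Pi_\mu\bigr)\qquad(i=1,2)$$ be their reductions onto irreps, which are operators on $\mathcal M_\mu$. Then there exists a $G$-invariant unitary $V$ on $\mathcal H$, i.e. a unitary with $VU(g)=U(g)V$ for all $g\in G$, such that $$|\langle\psi_2|V|\psi_1\rangle|\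 \ge\ 1-\frac12\sum_\mu\bigl\|F_1^{(\mu)}-F_2^{(\mu)}\bigr\|_1,$$ where $\|\cdot\|_1$ is the trace norm (the sum of the singular values). -/

import Mathlib

open scoped TensorProduct

universe u v

noncomputable section

/-- The linear representation underlying a unitary representation `U` of `G` on `H`;
unitary operators are linear isometric bijections `H ≃ₗᵢ[ℂ] H`. -/
def unitaryRepToRepresentation {G : Type v} [Group G] {H : Type u} [NormedAddCommGroup H]
    [InnerProductSpace ℂ H] (U : G →* (H ≃ₗᵢ[ℂ] H)) : Representation ℂ G H where
  toFun g := (U g).toLinearEquiv.toLinearMap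
  map_one' := by ext x; simp
  map_mul' g h := by ext x; simp

/-- A unitary operator `V` is `G`-invariant if `V U(g) = U(g) V` for all `g`. -/
def IsGInvariantUnitary {G : Type v} [Group G] {H : Type u} [NormedAddCommGroup H]
    [InnerProductSpace ℂ H] (U : G →* (H ≃ₗᵢ[ℂ] H)) (V : H ≃ₗᵢ[ℂ] H) : Prop :=
  ∀ g : G, V * U g = U g * V

/-- A decomposition `H ≅ ⨁_μ M_μ ⊗ N_μ`, `U(g) ≅ ⨁_μ U_μ(g) ⊗ 1`, of a unitary representation into
irreps: the `U_μ` are pairwise inequivalent irreducible unitary representations on `M_μ`, and the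
`N_μ` are the multiplicity spaces. -/
structure IrrepDecomposition {G : Type v} [Group G] {H : Type u} [NormedAddCommGroup H]
    [InnerProductSpace ℂ H] (U : G →* (H ≃ₗᵢ[ℂ] H)) where
  ι : Type u
  [fintypeι : Fintype ι]
  [decEqι : DecidableEq ι]
  M : ι → Type u
  N : ι → Type u
  [normedM : ∀ μ, NormedAddCommGroup (M μ)]
  [innerM : ∀ μ, InnerProductSpace ℂ (M μ)]
  [finM : ∀ μ, FiniteDimensional ℂ (M μ)]
  [normedN : ∀ μ, NormedAddCommGroup (N μ)]
  [innerN : ∀ μ, InnerProductSpace ℂ (N μ)]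
  [finN : ∀ μ, FiniteDimensional ℂ (N μ)]
  irrep : ∀ μ, G →* (M μ ≃ₗᵢ[ℂ] M μ)
  irreducible : ∀ μ, (unitaryRepToRepresentation (irrep μ)).IsIrreducible
  inequivalent : ∀ μ ν, μ ≠ ν →
    IsEmpty ((unitaryRepToRepresentation (irrep μ)).Equiv (unitaryRepToRepresentation (irrep ν)))
  iso : H ≃ₗᵢ[ℂ] PiLp 2 (fun μ => M μ ⊗[ℂ] N μ)
  iso_apply : ∀ (g : G) (x : H) (μ : ι),
    iso (U g x) μ =
      TensorProduct.map (irrep μ g).toLinearEquiv.toLinearMap LinearMap.id (iso x μ)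

attribute [instance] IrrepDecomposition.fintypeι IrrepDecomposition.decEqι
  IrrepDecomposition.normedM IrrepDecomposition.innerM IrrepDecomposition.finM
  IrrepDecomposition.normedN IrrepDecomposition.innerN IrrepDecomposition.finN

/-- The partial trace `tr_N` of operators on `M ⊗ N`: the linear map with
`A ⊗ B ↦ tr(B) A`. -/
def partialTraceRight (M N : Type u) [AddCommGroup M] [Module ℂ M] [FiniteDimensional ℂ M]
    [AddCommGroup N] [Module ℂ N] [FiniteDimensional ℂ N] :
    (M ⊗[ℂ] N →ₗ[ℂ] M ⊗[ℂ] N) →ₗ[ℂ] (M →ₗ[ℂ] M) :=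
  (TensorProduct.rid ℂ (M →ₗ[ℂ] M)).toLinearMap ∘ₗ
    LinearMap.lTensor (M →ₗ[ℂ] M) (LinearMap.trace ℂ N) ∘ₗ
    (homTensorHomEquiv ℂ M N M N).symm.toLinearMap

theorem partialTraceRight_map (M N : Type u) [AddCommGroup M] [Module ℂ M] [FiniteDimensional ℂ M]
    [AddCommGroup N] [Module ℂ N] [FiniteDimensional ℂ N] (A : M →ₗ[ℂ] M) (B : N →ₗ[ℂ] N) :
    partialTraceRight M N (TensorProduct.map A B) = LinearMap.trace ℂ N B • A := by
  have h : (homTensorHomEquiv ℂ M N M N).symm (TensorProduct.map A B) = A ⊗ₜ[ℂ] B := by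
    rw [LinearEquiv.symm_apply_eq]; simp
  simp [partialTraceRight, h]

/-- The trace norm `‖T‖₁ = tr √(T†T)`: the sum of the singular values of `T`. -/
def traceNorm {E : Type u} [NormedAddCommGroup E] [InnerProductSpace ℂ E] [FiniteDimensional ℂ E]
    (T : E →ₗ[ℂ] E) : ℝ :=
  ∑ i ∈ Finset.range (Module.finrank ℂ E), T.singularValues i

/-- The density operator `|ψ⟩⟨ψ|`. -/
def pureState {H : Type u} [NormedAddCommGroup H] [InnerProductSpace ℂ H] (ψ : H) : H →ₗ[ℂ] H :=
  (InnerProductSpace.rankOne ℂ ψ ψ).toLinearMap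

namespace IrrepDecomposition

/-- The embedding of the sector `M_μ ⊗ N_μ` into `H`. -/
def ofSector {G : Type v} [Group G] {H : Type u} [NormedAddCommGroup H]
    [InnerProductSpace ℂ H] {U : G →* (H ≃ₗᵢ[ℂ] H)} (D : IrrepDecomposition U) (μ : D.ι) :
    D.M μ ⊗[ℂ] D.N μ →ₗ[ℂ] H :=
  D.iso.symm.toLinearEquiv.toLinearMap ∘ₗ
    (WithLp.linearEquiv 2 ℂ (∀ ν, D.M ν ⊗[ℂ] D.N ν)).symm.toLinearMap ∘ₗ
    LinearMap.single ℂ (fun ν => D.M ν ⊗[ℂ] D.N ν) μ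

/-- The component in the sector `M_μ ⊗ N_μ` of a vector of `H` (the adjoint of `ofSector`). -/
def toSector {G : Type v} [Group G] {H : Type u} [NormedAddCommGroup H]
    [InnerProductSpace ℂ H] {U : G →* (H ≃ₗᵢ[ℂ] H)} (D : IrrepDecomposition U) (μ : D.ι) :
    H →ₗ[ℂ] D.M μ ⊗[ℂ] D.N μ :=
  LinearMap.proj μ ∘ₗ (WithLp.linearEquiv 2 ℂ (∀ ν, D.M ν ⊗[ℂ] D.N ν)).toLinearMap ∘ₗ
    D.iso.toLinearEquiv.toLinearMap

/-- The projection `Π_μ` of `H` onto the sector of the irrep `μ`. -/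
def sectorProj {G : Type v} [Group G] {H : Type u} [NormedAddCommGroup H]
    [InnerProductSpace ℂ H] {U : G →* (H ≃ₗᵢ[ℂ] H)} (D : IrrepDecomposition U) (μ : D.ι) :
    H →ₗ[ℂ] H :=
  D.ofSector μ ∘ₗ D.toSector μ

/-- The reduction `tr_{N_μ}(Π_μ ρ Π_μ)` of `ρ` onto the irrep `μ`, where `Π_μ ρ Π_μ` is regarded as
an operator on the sector `M_μ ⊗ N_μ`. -/
def reduction {G : Type v} [Group G] {H : Type u} [NormedAddCommGroup H]
    [InnerProductSpace ℂ H] {U : G →* (H ≃ₗᵢ[ℂ] H)} (D : IrrepDecomposition U)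
    (ρ : H →ₗ[ℂ] H) (μ : D.ι) : D.M μ →ₗ[ℂ] D.M μ :=
  partialTraceRight (D.M μ) (D.N μ)
    (D.toSector μ ∘ₗ (D.sectorProj μ ∘ₗ ρ ∘ₗ D.sectorProj μ) ∘ₗ D.ofSector μ)

end IrrepDecomposition

end

universe w

noncomputable section

/-! ### Trace norm, unitary maximisation of traces, and the Powers–Størmer inequality -/

section Operators

variable {E : Type u} {F : Type w}
  [NormedAddCommGroup E] [InnerProductSpace ℂ E] [FiniteDimensional ℂ E]
  [NormedAddCommGroup F] [InnerProductSpace ℂ F] [FiniteDimensional ℂ F]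

/-! For the inequality, fix a sector `M ⊗ N` and an orthonormal basis of `N`. A vector `∑ a_j ⊗ c_j`
becomes the operator `X` sending the `j`-th coordinate vector to `a_j`, and its reduction onto `M`
is `X X†`. A unitary on `N` turns the overlap of two such vectors into `tr(Y† X V)`. The best `V`
does at least as well as any contraction in place of `V`. Polar decompositions supply a contraction
giving `tr(B A)`, with `A = √(X X†)` and `B = √(Y Y†)`. Powers–Størmer then gives `tr A² + tr B² - 2
tr(B A) ≤ ‖A² - B²‖₁`.

Unitaries on the multiplicity spaces commute with `G`. The sector bounds concern real parts, so they
add up without phase cancellation, and the squared norms of the components sum to 1.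

Existence of a decomposition is complete reducibility: orthogonal complements of invariant subspaces
are invariant, so minimal ones can be split off. Schur's lemma upgrades linear equivalence to
unitary equivalence, and each class of equivalent summands is collected into one `M ⊗ N`. -/

theorem inner_apply_eigenvectorBasis_adjoint_comp_self (T : E →ₗ[ℂ] F)
    (i j : Fin (Module.finrank ℂ E)) :
    inner ℂ (T (T.isSymmetric_adjoint_comp_self.eigenvectorBasis rfl i))
      (T (T.isSymmetric_adjoint_comp_self.eigenvectorBasis rfl j)) =
      if i = j then ((T.singularValues i : ℂ)) ^ 2 else 0 := by
  rw [← LinearMap.adjoint_inner_right, ← LinearMap.comp_apply,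
    LinearMap.IsSymmetric.apply_eigenvectorBasis, inner_smul_right,
    OrthonormalBasis.inner_eq_ite, ← T.sq_singularValues_fin rfl]
  split_ifs with h
  · subst h; simp
  · simp

theorem norm_apply_eigenvectorBasis_adjoint_comp_self (T : E →ₗ[ℂ] F)
    (i : Fin (Module.finrank ℂ E)) :
    ‖T (T.isSymmetric_adjoint_comp_self.eigenvectorBasis rfl i)‖ = T.singularValues i := by
  have h := inner_apply_eigenvectorBasis_adjoint_comp_self T i i
  rw [if_pos rfl, inner_self_eq_norm_sq_to_K] at h
  have h' : ‖T (T.isSymmetric_adjoint_comp_self.eigenvectorBasis rfl i)‖ ^ 2 =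
      T.singularValues i ^ 2 := Complex.ofReal_injective (by push_cast; exact h)
  exact (sq_eq_sq₀ (norm_nonneg _) (T.singularValues_nonneg _)).1 h'

/-- Expand `e k` in the right singular vectors `v i`. For fixed `i`, Cauchy–Schwarz over `k` bounds
the contribution by `‖v i‖ ‖T (v i)‖`, which is the `i`-th singular value. -/
theorem sum_norm_inner_apply_le_traceNorm (T : E →ₗ[ℂ] E) {κ : Type*} [Fintype κ]
    (e : OrthonormalBasis κ ℂ E) :
    ∑ k, ‖inner ℂ (e k) (T (e k))‖ ≤ traceNorm T := by
  set v := T.isSymmetric_adjoint_comp_self.eigenvectorBasis rfl with hv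
  have hT : ∀ k, inner ℂ (e k) (T (e k)) =
      ∑ i, inner ℂ (v i) (e k) * inner ℂ (e k) (T (v i)) := by
    intro k
    conv_lhs => rw [← v.sum_repr (e k)]
    simp only [OrthonormalBasis.repr_apply_apply, map_sum, map_smul, inner_sum,
      inner_smul_right]
    simp [v.sum_repr' (e k)]
  calc ∑ k, ‖inner ℂ (e k) (T (e k))‖
      ≤ ∑ k, ∑ i, ‖inner ℂ (e k) (v i)‖ * ‖inner ℂ (e k) (T (v i))‖ := by
        refine Finset.sum_le_sum fun k _ => ?_
        rw [hT]
        refine (norm_sum_le _ _).trans (Finset.sum_le_sum fun i _ => ?_)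
        rw [norm_mul, norm_inner_symm]
    _ = ∑ i, ∑ k, ‖inner ℂ (e k) (v i)‖ * ‖inner ℂ (e k) (T (v i))‖ := Finset.sum_comm
    _ ≤ ∑ i : Fin (Module.finrank ℂ E), T.singularValues i := by
        refine Finset.sum_le_sum fun i _ => ?_
        refine (Real.sum_mul_le_sqrt_mul_sqrt _ _ _).trans ?_
        rw [e.sum_sq_norm_inner_right, e.sum_sq_norm_inner_right, Real.sqrt_sq (norm_nonneg _),
          Real.sqrt_sq (norm_nonneg _), hv, norm_apply_eigenvectorBasis_adjoint_comp_self]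
        simp
    _ = traceNorm T := by
        rw [traceNorm, Finset.sum_range]

/-- Singular value decomposition of an endomorphism. -/
theorem exists_orthonormalBasis_apply_eq_singularValues_smul (T : E →ₗ[ℂ] E) :
    ∃ v w : OrthonormalBasis (Fin (Module.finrank ℂ E)) ℂ E,
      ∀ i, T (v i) = (T.singularValues i : ℂ) • w i := by
  set v := T.isSymmetric_adjoint_comp_self.eigenvectorBasis rfl with hv
  -- Only nonzero singular values determine a left singular vector; the others are filled in by
  -- extending to an orthonormal basis.
  let s : Set (Fin (Module.finrank ℂ E)) := {i | T.singularValues i ≠ 0}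
  have hs : Orthonormal ℂ (s.domRestrict fun i => (T.singularValues i : ℂ)⁻¹ • T (v i)) := by
    rw [orthonormal_iff_ite]
    rintro ⟨i, hi⟩ ⟨j, hj⟩
    have hi' : (T.singularValues i : ℂ) ≠ 0 := by exact_mod_cast hi
    simp only [Set.domRestrict_apply, inner_smul_left, inner_smul_right, Subtype.mk.injEq]
    rw [hv, inner_apply_eigenvectorBasis_adjoint_comp_self]
    split_ifs with h
    · subst h
      simp only [map_inv₀, Complex.conj_ofReal]
      field_simp
    · simp
  obtain ⟨w, hw⟩ := hs.exists_orthonormalBasis_extension_of_card_eq (by simp)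
  refine ⟨v, w, fun i => ?_⟩
  by_cases hi : T.singularValues i = 0
  · have := norm_apply_eigenvectorBasis_adjoint_comp_self T i
    rw [hi, norm_eq_zero] at this
    rw [hi, this]; simp
  · have hi' : (T.singularValues i : ℂ) ≠ 0 := by exact_mod_cast hi
    rw [hw i hi, smul_smul, mul_inv_cancel₀ hi', one_smul]

/-- In a singular value decomposition `K v_i = σ_i w_i`, the trace of `K C` is `∑ σ_i ⟨v_i, C w_i⟩`.
Each inner product has real part at most 1, and the unitary `w_i ↦ v_i` makes all of them equal to
1. -/
theorem exists_unitary_re_trace_comp_le (K : E →ₗ[ℂ] E) :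
    ∃ V : E ≃ₗᵢ[ℂ] E, ∀ C : E →ₗ[ℂ] E, (∀ x, ‖C x‖ ≤ ‖x‖) →
      (LinearMap.trace ℂ E (K ∘ₗ C)).re ≤
        (LinearMap.trace ℂ E (K ∘ₗ V.toLinearEquiv.toLinearMap)).re := by
  obtain ⟨v, w, hvw⟩ := exists_orthonormalBasis_apply_eq_singularValues_smul K
  refine ⟨w.equiv v (Equiv.refl _), fun C hC => ?_⟩
  have h1 : LinearMap.trace ℂ E
      (K ∘ₗ (w.equiv v (Equiv.refl _)).toLinearEquiv.toLinearMap) =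
      ∑ i : Fin (Module.finrank ℂ E), (K.singularValues i : ℂ) := by
    rw [LinearMap.trace_eq_sum_inner _ w]
    refine Finset.sum_congr rfl fun i _ => ?_
    rw [LinearMap.comp_apply]
    simp only [LinearEquiv.coe_coe, LinearIsometryEquiv.coe_toLinearEquiv,
      OrthonormalBasis.equiv_apply_basis, Equiv.refl_apply]
    rw [hvw, inner_smul_right]
    simp
  have h2 : LinearMap.trace ℂ E (K ∘ₗ C) =
      ∑ i : Fin (Module.finrank ℂ E), (K.singularValues i : ℂ) * inner ℂ (v i) (C (w i)) := by
    rw [LinearMap.trace_comp_comm', LinearMap.trace_eq_sum_inner _ v]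
    refine Finset.sum_congr rfl fun i _ => ?_
    rw [LinearMap.comp_apply, hvw, map_smul, inner_smul_right]
  rw [h1, h2, Complex.re_sum, Complex.re_sum]
  refine Finset.sum_le_sum fun i _ => ?_
  rw [Complex.re_ofReal_mul, Complex.ofReal_re]
  refine mul_le_of_le_one_right (K.singularValues_nonneg _) ?_
  calc (inner ℂ (v i) (C (w i))).re ≤ ‖inner ℂ (v i) (C (w i))‖ := Complex.re_le_norm _
    _ ≤ ‖v i‖ * ‖C (w i)‖ := norm_inner_le_norm _ _
    _ ≤ 1 * 1 := by
      gcongr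
      · simp
      · simpa using hC (w i)
    _ = 1 := one_mul 1

theorem exists_isPositive_comp_self_eq {P : E →ₗ[ℂ] E} (hP : P.IsPositive) :
    ∃ A : E →ₗ[ℂ] E, A.IsPositive ∧ A ∘ₗ A = P := by
  have := FiniteDimensional.complete ℂ E
  have hP' : (0 : E →L[ℂ] E) ≤ LinearMap.toContinuousLinearMap P := by
    rw [ContinuousLinearMap.nonneg_iff_isPositive]
    exact (LinearMap.isPositive_toContinuousLinearMap_iff P).2 hP
  refine ⟨(CFC.sqrt (LinearMap.toContinuousLinearMap P)).toLinearMap, ?_, ?_⟩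
  · have := CFC.sqrt_nonneg (LinearMap.toContinuousLinearMap P)
    rw [ContinuousLinearMap.nonneg_iff_isPositive] at this
    exact this.toLinearMap
  · have := CFC.sqrt_mul_sqrt_self _ hP'
    ext x
    exact DFunLike.congr_fun this x

theorem norm_adjoint_apply_le {C : E →ₗ[ℂ] F} (hC : ∀ x, ‖C x‖ ≤ ‖x‖) (y : F) :
    ‖LinearMap.adjoint C y‖ ≤ ‖y‖ := by
  by_contra! h
  have h0 : 0 < ‖LinearMap.adjoint C y‖ := (norm_nonneg y).trans_lt h
  have h1 : ‖LinearMap.adjoint C y‖ * ‖LinearMap.adjoint C y‖ ≤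
      ‖y‖ * ‖LinearMap.adjoint C y‖ := by
    rw [← inner_self_eq_norm_mul_norm (𝕜 := ℂ), LinearMap.adjoint_inner_left]
    exact (RCLike.re_le_norm _).trans ((norm_inner_le_norm _ _).trans (by gcongr; exact hC _))
  nlinarith

/-- Partial isometry relating two operators with `A† A = T† T`. -/
theorem exists_contraction_comp_eq (A : E →ₗ[ℂ] E) (T : E →ₗ[ℂ] F)
    (h : LinearMap.adjoint A ∘ₗ A = LinearMap.adjoint T ∘ₗ T) :
    ∃ C : E →ₗ[ℂ] F, (∀ x, ‖C x‖ ≤ ‖x‖) ∧ C ∘ₗ A = T ∧ LinearMap.adjoint C ∘ₗ C ∘ₗ A = A := by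
  have hi : ∀ x y, inner ℂ (T x) (T y) = inner ℂ (A x) (A y) := fun x y => by
    rw [← LinearMap.adjoint_inner_right, ← LinearMap.adjoint_inner_right,
      ← LinearMap.comp_apply, ← LinearMap.comp_apply, h]
  have hk : LinearMap.ker A ≤ LinearMap.ker T := fun x hx => by
    have := hi x x
    rw [LinearMap.mem_ker.1 hx, inner_zero_left, inner_self_eq_zero] at this
    exact this
  let C₀ : LinearMap.range A →ₗ[ℂ] F :=
    (LinearMap.ker A).liftQ T hk ∘ₗ A.quotKerEquivRange.symm.toLinearMap
  have hC₀ : ∀ x, C₀ ⟨A x, LinearMap.mem_range_self A x⟩ = T x := fun x => by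
    simp only [C₀, LinearMap.comp_apply, LinearEquiv.coe_coe]
    rw [LinearMap.quotKerEquivRange_symm_apply_image A x (LinearMap.mem_range_self A x)]
    simp
  have hiso : ∀ y z, inner ℂ (C₀ y) (C₀ z) = inner ℂ y z := by
    rintro ⟨_, x, rfl⟩ ⟨_, z, rfl⟩
    rw [hC₀, hC₀, hi]; rfl
  let P := (LinearMap.range A).orthogonalProjectionOnto
  have hPA : ∀ x, P (A x) = ⟨A x, LinearMap.mem_range_self A x⟩ := fun x =>
    Submodule.orthogonalProjectionOnto_mem_subspace_eq_self
      (⟨A x, LinearMap.mem_range_self A x⟩ : LinearMap.range A)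
  -- `A x ↦ T x` is a well-defined isometry on the range of `A`; it is extended by zero on the
  -- orthogonal complement.
  refine ⟨C₀ ∘ₗ P.toLinearMap, fun x => ?_, ?_, ?_⟩
  · have : ‖C₀ (P x)‖ = ‖P x‖ := by
      rw [@norm_eq_sqrt_re_inner ℂ, hiso, ← @norm_eq_sqrt_re_inner ℂ]
    exact this.trans_le (Submodule.norm_orthogonalProjectionOnto_apply_le _ x)
  · ext x
    simp [hPA, hC₀]
  · ext x
    refine ext_inner_right ℂ fun y => ?_
    rw [LinearMap.comp_apply, LinearMap.adjoint_inner_left]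
    simp only [LinearMap.comp_apply, ContinuousLinearMap.coe_coe, hiso, hPA]
    exact Submodule.inner_orthogonalProjectionOnto_eq_of_mem_left _ _

/-- The Powers–Størmer inequality. -/
theorem re_trace_sub_le_traceNorm_sub {A B : E →ₗ[ℂ] E} (hA : A.IsPositive) (hB : B.IsPositive) :
    (LinearMap.trace ℂ E (A ∘ₗ A)).re + (LinearMap.trace ℂ E (B ∘ₗ B)).re -
      2 * (LinearMap.trace ℂ E (B ∘ₗ A)).re ≤ traceNorm (A ∘ₗ A - B ∘ₗ B) := by
  have hs : (A - B).IsSymmetric := hA.isSymmetric.sub hB.isSymmetric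
  -- In an eigenbasis of `A - B`, the diagonal entries of `A² - B²` have real part `d (a + b)`,
  -- where `d = a - b`. Positivity gives `|d| ≤ a + b`, hence `d² ≤ |d| (a + b)`.
  set e := hs.eigenvectorBasis rfl
  set d := hs.eigenvalues rfl
  have hde : ∀ i, A (e i) - B (e i) = (d i : ℂ) • e i := fun i =>
    hs.apply_eigenvectorBasis rfl i
  have hpos : ∀ {T : E →ₗ[ℂ] E}, T.IsPositive → ∀ x, 0 ≤ (inner ℂ x (T x)).re :=
    fun hT x => hT.re_inner_nonneg_right x
  refine le_trans ?_ (sum_norm_inner_apply_le_traceNorm _ e)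
  have hcomm : LinearMap.trace ℂ E (A ∘ₗ B) = LinearMap.trace ℂ E (B ∘ₗ A) :=
    LinearMap.trace_comp_comm' _ _
  have htr : (LinearMap.trace ℂ E (A ∘ₗ A)).re + (LinearMap.trace ℂ E (B ∘ₗ B)).re -
      2 * (LinearMap.trace ℂ E (B ∘ₗ A)).re = ∑ i, d i ^ 2 := by
    have : LinearMap.trace ℂ E ((A - B) ∘ₗ (A - B)) = ∑ i, (d i : ℂ) ^ 2 := by
      rw [LinearMap.trace_eq_sum_inner _ e]
      refine Finset.sum_congr rfl fun i _ => ?_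
      rw [LinearMap.comp_apply, ← hs, LinearMap.sub_apply, hde]
      rw [inner_smul_left, inner_smul_right]
      simp [sq]
    have h2 := congrArg Complex.re this
    rw [LinearMap.sub_comp, LinearMap.comp_sub, LinearMap.comp_sub] at h2
    simp only [map_sub, hcomm, Complex.sub_re, Complex.re_sum] at h2
    norm_cast at h2
    rw [← h2]; ring
  rw [htr]
  refine Finset.sum_le_sum fun i _ => ?_
  set a := (inner ℂ (e i) (A (e i))).re with ha
  set b := (inner ℂ (e i) (B (e i))).re with hb
  have hab : a - b = d i := by
    rw [ha, hb, ← Complex.sub_re, ← inner_sub_right, hde, inner_smul_right]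
    simp
  have hre : (inner ℂ (e i) ((A ∘ₗ A - B ∘ₗ B) (e i))).re = d i * (a + b) := by
    have e1 : inner ℂ (e i) ((A ∘ₗ A - B ∘ₗ B) (e i)) =
        inner ℂ (A (e i)) (A (e i)) - inner ℂ (B (e i)) (B (e i)) := by
      rw [LinearMap.sub_apply, inner_sub_right, LinearMap.comp_apply, LinearMap.comp_apply,
        ← hA.isSymmetric, ← hB.isSymmetric]
    have hAe : A (e i) = B (e i) + (d i : ℂ) • e i := by rw [← hde]; abel
    have hBe : inner ℂ (B (e i)) (e i) = inner ℂ (e i) (B (e i)) := hB.isSymmetric _ _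
    have hd' : a = b + d i := by linarith
    rw [e1, hAe]
    simp only [inner_add_left, inner_add_right, inner_smul_left, inner_smul_right, hBe,
      Complex.conj_ofReal, Complex.sub_re, Complex.add_re, Complex.re_ofReal_mul, ← hb]
    simp
    rw [hd']; ring
  refine le_trans ?_ (Complex.abs_re_le_norm _)
  rw [hre, abs_mul]
  have ha0 : 0 ≤ a := hpos hA _
  have hb0 : 0 ≤ b := hpos hB _
  rw [← sq_abs, sq]
  refine mul_le_mul_of_nonneg_left ?_ (abs_nonneg _)
  rw [← hab, abs_of_nonneg (add_nonneg ha0 hb0), abs_le]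
  constructor <;> linarith

/-- This is Uhlmann's argument: the polar forms `X† = C A` and `Y† = D B` make `C D†` a contraction
with `tr(Y† X C D†) = tr(B A)`. The optimal unitary does no worse, and Powers–Størmer bounds `tr(B
A)` from below. -/
theorem exists_unitary_half_sub_traceNorm_le_re_trace (X Y : F →ₗ[ℂ] E) :
    ∃ V : F ≃ₗᵢ[ℂ] F,
      1 / 2 * ((LinearMap.trace ℂ E (X ∘ₗ LinearMap.adjoint X)).re +
        (LinearMap.trace ℂ E (Y ∘ₗ LinearMap.adjoint Y)).re -
        traceNorm (X ∘ₗ LinearMap.adjoint X - Y ∘ₗ LinearMap.adjoint Y)) ≤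
      (LinearMap.trace ℂ F
        ((LinearMap.adjoint Y ∘ₗ X) ∘ₗ V.toLinearEquiv.toLinearMap)).re := by
  obtain ⟨A, hA, hAX⟩ := exists_isPositive_comp_self_eq (LinearMap.isPositive_self_comp_adjoint X)
  obtain ⟨B, hB, hBY⟩ := exists_isPositive_comp_self_eq (LinearMap.isPositive_self_comp_adjoint Y)
  have hA' : LinearMap.adjoint A = A := hA.isSelfAdjoint
  have hB' : LinearMap.adjoint B = B := hB.isSelfAdjoint
  obtain ⟨C, hC, hCA, hCCA⟩ := exists_contraction_comp_eq A (LinearMap.adjoint X)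
    (by rw [hA', LinearMap.adjoint_adjoint, hAX])
  obtain ⟨D, hD, hDB, hDDB⟩ := exists_contraction_comp_eq B (LinearMap.adjoint Y)
    (by rw [hB', LinearMap.adjoint_adjoint, hBY])
  obtain ⟨V, hV⟩ := exists_unitary_re_trace_comp_le (LinearMap.adjoint Y ∘ₗ X)
  refine ⟨V, le_trans ?_ (hV (C ∘ₗ LinearMap.adjoint D) fun x =>
    (hC _).trans (norm_adjoint_apply_le hD x))⟩
  -- Take adjoints in `C† C A = A` and use `A C† = X`.
  have hX : X ∘ₗ C = A := by
    have := congrArg LinearMap.adjoint hCCA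
    rwa [← LinearMap.comp_assoc, LinearMap.adjoint_comp, LinearMap.adjoint_comp,
      LinearMap.adjoint_adjoint, ← LinearMap.comp_assoc, hA',
      show A ∘ₗ LinearMap.adjoint C = X by
        rw [← LinearMap.adjoint_adjoint X, ← hCA, LinearMap.adjoint_comp, hA']] at this
  have hY : LinearMap.adjoint D ∘ₗ LinearMap.adjoint Y = B := by rw [← hDB, hDDB]
  have htr : LinearMap.trace ℂ F ((LinearMap.adjoint Y ∘ₗ X) ∘ₗ C ∘ₗ LinearMap.adjoint D) =
      LinearMap.trace ℂ E (B ∘ₗ A) := by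
    rw [← LinearMap.comp_assoc, LinearMap.trace_comp_comm', LinearMap.comp_assoc, hX,
      ← LinearMap.comp_assoc, hY]
  rw [htr, ← hAX, ← hBY]
  linarith [re_trace_sub_le_traceNorm_sub hA hB]

end Operators

/-! ### Vectors of `M ⊗ N` as operators, and their partial traces -/

section Tensor

variable {M N : Type u} [NormedAddCommGroup M] [InnerProductSpace ℂ M]
  [NormedAddCommGroup N] [InnerProductSpace ℂ N]

theorem exists_eq_sum_tmul_orthonormalBasis {κ : Type*} [Fintype κ] (c : OrthonormalBasis κ ℂ N)
    (x : M ⊗[ℂ] N) : ∃ a : κ → M, x = ∑ j, a j ⊗ₜ[ℂ] c j := by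
  obtain ⟨a, ha⟩ := TensorProduct.eq_repr_basis_right c.toBasis x
  refine ⟨a, ?_⟩
  rw [← ha, Finsupp.sum_fintype _ _ (by simp)]
  simp

theorem rankOne_tmul_tmul (a b : M) (c d : N) :
    (InnerProductSpace.rankOne ℂ (a ⊗ₜ[ℂ] c) (b ⊗ₜ[ℂ] d)).toLinearMap =
      TensorProduct.map (InnerProductSpace.rankOne ℂ a b).toLinearMap
        (InnerProductSpace.rankOne ℂ c d).toLinearMap := by
  ext p q
  simp [InnerProductSpace.rankOne_apply, TensorProduct.smul_tmul', smul_smul,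
    mul_comm]

theorem pureState_sum {κ : Type*} [Fintype κ] {E : Type u} [NormedAddCommGroup E]
    [InnerProductSpace ℂ E] (a : κ → E) :
    pureState (∑ j, a j) =
      ∑ j, ∑ k, (InnerProductSpace.rankOne ℂ (a j) (a k)).toLinearMap := by
  ext p
  simp [pureState, InnerProductSpace.rankOne_apply]
  rw [Finset.sum_comm]

theorem norm_sum_tmul_orthonormalBasis_sq {κ : Type*} [Fintype κ]
    (c : OrthonormalBasis κ ℂ N) (a : κ → M) :
    ‖∑ j, a j ⊗ₜ[ℂ] c j‖ ^ 2 = ∑ j, ‖a j‖ ^ 2 := by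
  classical
  apply Complex.ofReal_injective
  have h := inner_self_eq_norm_sq_to_K (𝕜 := ℂ) (∑ j, a j ⊗ₜ[ℂ] c j)
  push_cast
  refine h.symm.trans ?_
  simp only [sum_inner, inner_sum, TensorProduct.inner_tmul, c.inner_eq_ite]
  simp

/-- The linear map with prescribed values on the standard basis. -/
def sumCoordSMul {κ : Type*} [Fintype κ] (a : κ → M) : EuclideanSpace ℂ κ →ₗ[ℂ] M :=
  (EuclideanSpace.basisFun κ ℂ).toBasis.constr ℂ a

theorem sumCoordSMul_apply {κ : Type*} [Fintype κ] (a : κ → M) (z : EuclideanSpace ℂ κ) :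
    sumCoordSMul a z = ∑ j, z j • a j := by
  simp [sumCoordSMul, Module.Basis.constr_apply_fintype]

theorem sumCoordSMul_basisFun {κ : Type*} [Fintype κ] (a : κ → M) (j : κ) :
    sumCoordSMul a (EuclideanSpace.basisFun κ ℂ j) = a j := by
  have := (EuclideanSpace.basisFun κ ℂ).toBasis.constr_basis ℂ a j
  rwa [OrthonormalBasis.coe_toBasis] at this

variable [FiniteDimensional ℂ M] [FiniteDimensional ℂ N]

/-- The cross terms vanish because `tr |c_j⟩⟨c_k| = 0` for `j ≠ k`. -/
theorem partialTraceRight_pureState_sum_tmul {κ : Type*} [Fintype κ]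
    (c : OrthonormalBasis κ ℂ N) (a : κ → M) :
    partialTraceRight M N (pureState (∑ j, a j ⊗ₜ[ℂ] c j)) = ∑ j, pureState (a j) := by
  classical
  rw [pureState_sum, map_sum]
  refine Finset.sum_congr rfl fun j _ => ?_
  rw [map_sum, Finset.sum_eq_single j]
  · rw [rankOne_tmul_tmul, partialTraceRight_map, InnerProductSpace.trace_rankOne]
    simp [pureState]
  · intro k _ hk
    rw [rankOne_tmul_tmul, partialTraceRight_map, InnerProductSpace.trace_rankOne,
      c.inner_eq_ite, if_neg hk, zero_smul]
  · simp

/-- With `partialTraceRight_pureState_sum_tmul`, this identifies the reduction of a vector with `X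
X†`. -/
theorem sumCoordSMul_comp_adjoint {κ : Type*} [Fintype κ] (a : κ → M) :
    sumCoordSMul a ∘ₗ LinearMap.adjoint (sumCoordSMul a) = ∑ j, pureState (a j) := by
  ext p
  rw [LinearMap.comp_apply, sumCoordSMul_apply, LinearMap.sum_apply]
  refine Finset.sum_congr rfl fun j _ => ?_
  rw [← EuclideanSpace.basisFun_inner, LinearMap.adjoint_inner_right, sumCoordSMul_basisFun]
  rfl

theorem re_trace_sum_pureState {κ : Type*} [Fintype κ] (a : κ → M) :
    (LinearMap.trace ℂ M (∑ j, pureState (a j))).re = ∑ j, ‖a j‖ ^ 2 := by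
  simp only [map_sum, pureState, InnerProductSpace.trace_rankOne, Complex.re_sum]
  exact Finset.sum_congr rfl fun j _ => inner_self_eq_norm_sq (𝕜 := ℂ) (a j)

theorem exists_unitary_half_sub_traceNorm_le_re_inner_lTensor (x y : M ⊗[ℂ] N) :
    ∃ V : N ≃ₗᵢ[ℂ] N,
      1 / 2 * (‖x‖ ^ 2 + ‖y‖ ^ 2 - traceNorm (partialTraceRight M N (pureState x) -
        partialTraceRight M N (pureState y))) ≤ (inner ℂ y (V.lTensor M x)).re := by
  let c := stdOrthonormalBasis ℂ N
  obtain ⟨a, rfl⟩ := exists_eq_sum_tmul_orthonormalBasis c x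
  obtain ⟨b, rfl⟩ := exists_eq_sum_tmul_orthonormalBasis c y
  obtain ⟨V, hV⟩ := exists_unitary_half_sub_traceNorm_le_re_trace (sumCoordSMul a) (sumCoordSMul b)
  let e := EuclideanSpace.basisFun (Fin (Module.finrank ℂ N)) ℂ
  -- The unitary wanted on `N` has the transpose of the matrix of `V`: moving an operator across the
  -- tensor correspondence transposes it. Orthonormality of `c'` is that of the rows of `V`.
  let c' : Fin (Module.finrank ℂ N) → N := fun j => ∑ k, inner ℂ (e j) (V (e k)) • c k
  have hc' : Orthonormal ℂ c' := by
    rw [orthonormal_iff_ite]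
    intro i j
    have h := (e.map V).sum_inner_mul_inner (e j) (e i)
    rw [e.inner_eq_ite] at h
    simp only [c', sum_inner, inner_sum, inner_smul_left, inner_smul_right, c.inner_eq_ite,
      inner_conj_symm]
    simp only [OrthonormalBasis.map_apply] at h
    simp only [eq_comm (a := i) (b := j), ← h]
    simp [mul_comm]
  -- The extension from `Set.univ` adds nothing; it only packages `c'` as an orthonormal basis.
  have hr : Orthonormal ℂ (Set.univ.domRestrict c') := hc'.comp _ Subtype.val_injective
  obtain ⟨c'', hc''⟩ := hr.exists_orthonormalBasis_extension_of_card_eq (by simp)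
  replace hc'' : ∀ j, c'' j = c' j := fun j => hc'' j (Set.mem_univ j)
  refine ⟨c.equiv c'' (Equiv.refl _), ?_⟩
  simp only [partialTraceRight_pureState_sum_tmul, norm_sum_tmul_orthonormalBasis_sq]
  rw [sumCoordSMul_comp_adjoint, sumCoordSMul_comp_adjoint, re_trace_sum_pureState,
    re_trace_sum_pureState] at hV
  refine hV.trans (le_of_eq (congrArg Complex.re ?_))
  rw [LinearMap.trace_eq_sum_inner _ e]
  have hleft : ∀ k, inner ℂ (e k) (((LinearMap.adjoint (sumCoordSMul b) ∘ₗ sumCoordSMul a) ∘ₗ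
      V.toLinearEquiv.toLinearMap) (e k)) =
      ∑ j, inner ℂ (e j) (V (e k)) * inner ℂ (b k) (a j) := by
    intro k
    rw [LinearMap.comp_apply, LinearMap.comp_apply, LinearMap.adjoint_inner_right,
      sumCoordSMul_basisFun, sumCoordSMul_apply, inner_sum]
    refine Finset.sum_congr rfl fun j _ => ?_
    rw [inner_smul_right, ← EuclideanSpace.basisFun_inner]
    rfl
  simp only [hleft]
  simp [sum_inner, inner_sum, hc'', c', c.inner_eq_ite, inner_smul_right, mul_comm]
  exact Finset.sum_comm

end Tensor

/-! ### Assembling the sector estimates into an invariant unitary -/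

namespace IrrepDecomposition

variable {G : Type v} [Group G] {H : Type u} [NormedAddCommGroup H]
  [InnerProductSpace ℂ H] {U : G →* (H ≃ₗᵢ[ℂ] H)} (D : IrrepDecomposition U)

theorem toSector_apply (μ : D.ι) (x : H) : D.toSector μ x = D.iso x μ := rfl

theorem toSector_ofSector (μ : D.ι) (z : D.M μ ⊗[ℂ] D.N μ) :
    D.toSector μ (D.ofSector μ z) = z := by
  simp [toSector, ofSector]

theorem inner_ofSector_right (μ : D.ι) (x : H) (z : D.M μ ⊗[ℂ] D.N μ) :
    inner ℂ x (D.ofSector μ z) = inner ℂ (D.toSector μ x) z := by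
  rw [← D.iso.inner_map_map, PiLp.inner_apply, Finset.sum_eq_single μ]
  · simp [toSector, ofSector]
  · intro ν _ hν
    simp [ofSector, Pi.single_eq_of_ne hν]
  · simp

/-- Since `ofSector` is an isometric embedding with adjoint `toSector`, compressing `|ψ⟩⟨ψ|` to a
sector leaves the rank-one operator of the component of `ψ`. -/
theorem reduction_pureState (ψ : H) (μ : D.ι) :
    D.reduction (pureState ψ) μ =
      partialTraceRight (D.M μ) (D.N μ) (pureState (D.toSector μ ψ)) := by
  rw [reduction]
  congr 1
  ext z
  simp [sectorProj, toSector_ofSector, pureState, InnerProductSpace.rankOne_apply,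
    inner_ofSector_right]

/-- The unitary `⨁_μ 1 ⊗ W_μ` acting on the multiplicity spaces. -/
def multiplicityUnitary (W : ∀ μ, D.N μ ≃ₗᵢ[ℂ] D.N μ) : H ≃ₗᵢ[ℂ] H :=
  (D.iso.trans (LinearIsometryEquiv.piLpCongrRight 2 fun μ => (W μ).lTensor (D.M μ))).trans
    D.iso.symm

theorem iso_multiplicityUnitary_apply (W : ∀ μ, D.N μ ≃ₗᵢ[ℂ] D.N μ) (x : H) (μ : D.ι) :
    D.iso (D.multiplicityUnitary W x) μ = (W μ).lTensor (D.M μ) (D.iso x μ) := by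
  simp [multiplicityUnitary]

theorem isGInvariantUnitary_multiplicityUnitary (W : ∀ μ, D.N μ ≃ₗᵢ[ℂ] D.N μ) :
    IsGInvariantUnitary U (D.multiplicityUnitary W) := by
  intro g
  ext x
  apply D.iso.injective
  ext μ
  change D.iso (D.multiplicityUnitary W (U g x)) μ = D.iso (U g (D.multiplicityUnitary W x)) μ
  rw [iso_multiplicityUnitary_apply, D.iso_apply, D.iso_apply, iso_multiplicityUnitary_apply]
  generalize D.iso x μ = z
  change (TensorProduct.map LinearMap.id (W μ).toLinearEquiv.toLinearMap ∘ₗ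
    TensorProduct.map (D.irrep μ g).toLinearEquiv.toLinearMap LinearMap.id) z =
    (TensorProduct.map (D.irrep μ g).toLinearEquiv.toLinearMap LinearMap.id ∘ₗ
    TensorProduct.map LinearMap.id (W μ).toLinearEquiv.toLinearMap) z
  rw [← TensorProduct.map_comp, ← TensorProduct.map_comp]
  rfl

theorem exists_isGInvariantUnitary_le_norm_inner (ψ₁ ψ₂ : H) (h₁ : ‖ψ₁‖ = 1) (h₂ : ‖ψ₂‖ = 1) :
    ∃ V : H ≃ₗᵢ[ℂ] H, IsGInvariantUnitary U V ∧
      1 - 1 / 2 * ∑ μ, traceNorm (D.reduction (pureState ψ₁) μ - D.reduction (pureState ψ₂) μ)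
        ≤ ‖inner ℂ ψ₂ (V ψ₁)‖ := by
  choose W hW using fun μ => exists_unitary_half_sub_traceNorm_le_re_inner_lTensor
    (D.toSector μ ψ₁) (D.toSector μ ψ₂)
  refine ⟨D.multiplicityUnitary W, D.isGInvariantUnitary_multiplicityUnitary W,
    le_trans ?_ (Complex.re_le_norm _)⟩
  have hnorm : ∀ ψ : H, ‖ψ‖ = 1 → ∑ μ, ‖D.toSector μ ψ‖ ^ 2 = 1 := fun ψ h => by
    simp only [toSector_apply]
    rw [← PiLp.norm_sq_eq_of_L2, D.iso.norm_map, h, one_pow]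
  rw [← D.iso.inner_map_map, PiLp.inner_apply, Complex.re_sum]
  simp only [iso_multiplicityUnitary_apply, reduction_pureState]
  refine le_trans (le_of_eq ?_) (Finset.sum_le_sum fun μ _ => hW μ)
  rw [← Finset.mul_sum, Finset.sum_sub_distrib, Finset.sum_add_distrib, hnorm _ h₁, hnorm _ h₂]
  ring

end IrrepDecomposition

/-! ### Complete reducibility and existence of the decomposition -/

section Existence

variable {G : Type v} [Group G] {H : Type u} [NormedAddCommGroup H] [InnerProductSpace ℂ H]

/-- A subspace is invariant under a unitary representation. -/
def IsInvariantSubspace (U : G →* (H ≃ₗᵢ[ℂ] H)) (W : Submodule ℂ H) : Prop :=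
  ∀ g, ∀ x ∈ W, U g x ∈ W

/-- A minimal nonzero invariant subspace. -/
structure IsMinimalInvariantSubspace (U : G →* (H ≃ₗᵢ[ℂ] H)) (W : Submodule ℂ H) : Prop where
  invariant : IsInvariantSubspace U W
  ne_bot : W ≠ ⊥
  eq_bot_or_eq : ∀ W' ≤ W, IsInvariantSubspace U W' → W' = ⊥ ∨ W' = W

theorem inner_unitaryRep_apply_left (U : G →* (H ≃ₗᵢ[ℂ] H)) (g : G) (x y : H) :
    inner ℂ (U g x) y = inner ℂ x (U g⁻¹ y) := by
  rw [← (U g).inner_map_map x]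
  congr 1
  change y = (U g * U g⁻¹) y
  rw [← map_mul]
  simp

theorem IsInvariantSubspace.orthogonal {U : G →* (H ≃ₗᵢ[ℂ] H)} {W : Submodule ℂ H}
    (hW : IsInvariantSubspace U W) : IsInvariantSubspace U Wᗮ := by
  intro g x hx
  rw [Submodule.mem_orthogonal'] at hx ⊢
  intro w hw
  rw [inner_unitaryRep_apply_left]
  exact hx _ (hW _ _ hw)

theorem IsInvariantSubspace.inf {U : G →* (H ≃ₗᵢ[ℂ] H)} {W W' : Submodule ℂ H}
    (hW : IsInvariantSubspace U W) (hW' : IsInvariantSubspace U W') :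
    IsInvariantSubspace U (W ⊓ W') :=
  fun g x hx => ⟨hW g x hx.1, hW' g x hx.2⟩

/-- The restriction of a unitary representation to an invariant subspace. -/
def restrictUnitaryRep (U : G →* (H ≃ₗᵢ[ℂ] H)) (W : Submodule ℂ H)
    (hW : IsInvariantSubspace U W) : G →* (W ≃ₗᵢ[ℂ] W) where
  toFun g :=
    { toLinearEquiv := LinearEquiv.ofLinearMap
        ((U g).toLinearEquiv.toLinearMap.restrict (hW g))
        ((U g⁻¹).toLinearEquiv.toLinearMap.restrict (hW g⁻¹))
        (by
          ext x
          change (U g * U g⁻¹) x = x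
          rw [← map_mul]; simp)
        (by
          ext x
          change (U g⁻¹ * U g) x = x
          rw [← map_mul]; simp)
      norm_map' := fun x => (U g).norm_map x }
  map_one' := by
    ext x
    change U 1 x = x
    simp
  map_mul' g h := by
    ext x
    change U (g * h) x = U g (U h x)
    rw [map_mul]; rfl

/-- A subrepresentation of the restriction, pushed forward to `H`, is an invariant subspace inside
`W`, so minimality decides it. -/
theorem IsMinimalInvariantSubspace.isIrreducible {U : G →* (H ≃ₗᵢ[ℂ] H)} {W : Submodule ℂ H}
    (hW : IsMinimalInvariantSubspace U W) :
    (unitaryRepToRepresentation (restrictUnitaryRep U W hW.invariant)).IsIrreducible := by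
  have hne := (Submodule.nontrivial_iff_ne_bot).2 hW.ne_bot
  refine { exists_pair_ne := ⟨⊥, ⊤, fun h => ?_⟩, eq_bot_or_eq_top := fun a => ?_ }
  · exact (bot_ne_top : (⊥ : Submodule ℂ W) ≠ ⊤) (congrArg Subrepresentation.toSubmodule h)
  · have hinv : IsInvariantSubspace U (a.toSubmodule.map W.subtype) := by
      rintro g _ ⟨y, hy, rfl⟩
      exact ⟨_, a.apply_mem_toSubmodule g hy, rfl⟩
    rcases hW.eq_bot_or_eq _ (Submodule.map_subtype_le _ _) hinv with h | h
    · left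
      apply Subrepresentation.toSubmodule_injective
      refine Submodule.map_injective_of_injective W.subtype_injective ?_
      rw [h]
      exact (Submodule.map_bot _).symm
    · right
      apply Subrepresentation.toSubmodule_injective
      refine Submodule.map_injective_of_injective W.subtype_injective ?_
      rw [h]
      exact (Submodule.map_subtype_top W).symm

theorem IsInvariantSubspace.exists_isMinimalInvariantSubspace_le [FiniteDimensional ℂ H]
    {U : G →* (H ≃ₗᵢ[ℂ] H)} {W : Submodule ℂ H} (hW : IsInvariantSubspace U W) (hne : W ≠ ⊥) :
    ∃ A ≤ W, IsMinimalInvariantSubspace U A := by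
  obtain ⟨A, ⟨hAW, hA, hA0⟩, hmin⟩ :=
    (wellFounded_lt (α := Submodule ℂ H)).has_min
      {A | A ≤ W ∧ IsInvariantSubspace U A ∧ A ≠ ⊥} ⟨W, le_rfl, hW, hne⟩
  refine ⟨A, hAW, hA, hA0, fun B hBA hB => ?_⟩
  by_contra! h
  exact hmin B ⟨hBA.trans hAW, hB, h.1⟩ (lt_of_le_of_ne hBA h.2)

theorem IsInvariantSubspace.exists_finset_sup_eq [FiniteDimensional ℂ H]
    {U : G →* (H ≃ₗᵢ[ℂ] H)} {W : Submodule ℂ H} (hW : IsInvariantSubspace U W) :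
    ∃ s : Finset (Submodule ℂ H), (∀ A ∈ s, IsMinimalInvariantSubspace U A) ∧
      (s : Set (Submodule ℂ H)).Pairwise (· ⟂ ·) ∧ s.sup id = W := by
  classical
  induction W using (wellFounded_lt (α := Submodule ℂ H)).induction with
  | _ W ih =>
    by_cases hne : W = ⊥
    · exact ⟨∅, by simp, by simp, by simp [hne]⟩
    obtain ⟨A, hAW, hA⟩ := hW.exists_isMinimalInvariantSubspace_le hne
    have hsup : A ⊔ Aᗮ ⊓ W = W := Submodule.sup_orthogonal_inf_of_hasOrthogonalProjection hAW
    -- Equality would make `A` orthogonal to itself, hence zero.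
    have hlt : Aᗮ ⊓ W < W := by
      refine lt_of_le_of_ne inf_le_right fun h => hA.ne_bot ?_
      have h1 : A ≤ Aᗮ := hAW.trans (inf_eq_right.1 h)
      exact Submodule.isOrtho_self.1 h1
    obtain ⟨s, hs, hpair, hsW⟩ := ih _ hlt (hA.invariant.orthogonal.inf hW)
    refine ⟨insert A s, ?_, ?_, ?_⟩
    · intro B hB
      rcases Finset.mem_insert.1 hB with rfl | hB
      exacts [hA, hs B hB]
    · rw [Finset.coe_insert, Set.pairwise_insert]
      refine ⟨hpair, fun B hB _ => ?_⟩
      rw [Submodule.isOrtho_comm (U := B), and_self]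
      have hB' : B ≤ Aᗮ := ((Finset.le_sup (f := id) hB).trans hsW.le).trans inf_le_left
      exact (Submodule.isOrtho_iff_le.2 hB').symm
    · rw [Finset.sup_insert, hsW, id, hsup]

/-- A unitary operator intertwining two unitary representations. -/
def IsUnitaryIntertwiner {K : Type w} [NormedAddCommGroup K] [InnerProductSpace ℂ K]
    (U : G →* (H ≃ₗᵢ[ℂ] H)) (U' : G →* (K ≃ₗᵢ[ℂ] K)) (e : H ≃ₗᵢ[ℂ] K) : Prop :=
  ∀ g x, e (U g x) = U' g (e x)

/-- Equivalent irreducible unitary representations are unitarily equivalent. -/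
theorem exists_isUnitaryIntertwiner_of_equiv [FiniteDimensional ℂ H]
    {K : Type w} [NormedAddCommGroup K] [InnerProductSpace ℂ K] [FiniteDimensional ℂ K]
    (U : G →* (H ≃ₗᵢ[ℂ] H)) (U' : G →* (K ≃ₗᵢ[ℂ] K))
    (hU : (unitaryRepToRepresentation U).IsIrreducible)
    (φ : (unitaryRepToRepresentation U).Equiv (unitaryRepToRepresentation U')) :
    ∃ e : H ≃ₗᵢ[ℂ] K, IsUnitaryIntertwiner U U' e := by
  let T : H ≃ₗ[ℂ] K := φ.toLinearEquiv
  have hT : ∀ g x, T (U g x) = U' g (T x) := fun g x => 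
    Representation.IntertwiningMap.isIntertwining _ _ φ.toIntertwiningMap g x
  let S : H →ₗ[ℂ] H := LinearMap.adjoint T.toLinearMap ∘ₗ T.toLinearMap
  have hSinner : ∀ x y, inner ℂ (S x) y = inner ℂ (T x) (T y) := fun x y => by
    change inner ℂ (LinearMap.adjoint T.toLinearMap (T x)) y = _
    rw [LinearMap.adjoint_inner_left]
    rfl
  have hS : ∀ g x, S (U g x) = U g (S x) := fun g x => by
    refine ext_inner_right ℂ fun y => ?_
    rw [inner_unitaryRep_apply_left, hSinner, hSinner, hT, hT, inner_unitaryRep_apply_left]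
  let f : Representation.IntertwiningMap (unitaryRepToRepresentation U)
      (unitaryRepToRepresentation U) := ⟨S, fun g => by ext x; exact hS g x⟩
  -- Schur's lemma: `T† T` commutes with `U`, so it is a scalar `c`, and `T / √c` is unitary.
  obtain ⟨c, hc⟩ := (Representation.IsIrreducible.algebraMap_intertwiningMap_bijective_of_isAlgClosed
    (ρ := unitaryRepToRepresentation U)).2 f
  have hSc : ∀ x, S x = c • x := fun x => by
    change f x = _
    rw [← hc]
    rfl
  have hnorm : ∀ x, ‖T x‖ ^ 2 = c.re * ‖x‖ ^ 2 := fun x => by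
    have h1 := hSinner x x
    have h2 : inner ℂ x x = ((‖x‖ ^ 2 : ℝ) : ℂ) := by
      rw [inner_self_eq_norm_sq_to_K]; push_cast; rfl
    have h3 : inner ℂ (T x) (T x) = ((‖T x‖ ^ 2 : ℝ) : ℂ) := by
      rw [inner_self_eq_norm_sq_to_K]; push_cast; rfl
    rw [hSc, inner_smul_left, h2, h3] at h1
    have h4 := congrArg Complex.re h1
    rw [Complex.re_mul_ofReal, Complex.conj_re, Complex.ofReal_re] at h4
    exact h4.symm
  have hnt : Nontrivial H := by
    by_contra h
    rw [not_nontrivial_iff_subsingleton] at h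
    refine (bot_ne_top : (⊥ : Subrepresentation (unitaryRepToRepresentation U)) ≠ ⊤) ?_
    exact Subrepresentation.toSubmodule_injective (Subsingleton.elim _ _)
  obtain ⟨x₀, hx₀⟩ := exists_ne (0 : H)
  have hcpos : 0 < c.re := by
    have h1 : 0 < ‖T x₀‖ ^ 2 := by
      have : T x₀ ≠ 0 := fun h => hx₀ (T.map_eq_zero_iff.1 h)
      positivity
    rw [hnorm] at h1
    exact pos_of_mul_pos_left h1 (by positivity)
  have hr : ((Real.sqrt c.re)⁻¹ : ℂ) ≠ 0 := by
    have := (Real.sqrt_pos.2 hcpos).ne'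
    exact inv_ne_zero (by exact_mod_cast this)
  refine ⟨⟨T.trans (LinearEquiv.smulOfNeZero ℂ K _ hr), fun x => ?_⟩, fun g x => ?_⟩
  · change ‖((Real.sqrt c.re)⁻¹ : ℂ) • T x‖ = ‖x‖
    have h1 : ‖T x‖ = Real.sqrt c.re * ‖x‖ := by
      rw [← Real.sqrt_sq (norm_nonneg (T x)), hnorm, Real.sqrt_mul hcpos.le,
        Real.sqrt_sq (norm_nonneg x)]
    rw [norm_smul, h1, norm_inv, Complex.norm_real, Real.norm_of_nonneg (Real.sqrt_nonneg _),
      inv_mul_cancel_left₀ (Real.sqrt_pos.2 hcpos).ne']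
  · change ((Real.sqrt c.re)⁻¹ : ℂ) • T (U g x) = U' g (((Real.sqrt c.re)⁻¹ : ℂ) • T x)
    rw [hT, map_smul]

/-- If the spaces `W j` with `f j = μ` are all identified with `M μ`, then the direct sum of the
`W j` is the direct sum of the `M μ ⊗ ℂ^(f⁻¹ μ)`: the underlying linear map. -/
def groupFibers {κ ι : Type u} [Fintype κ] [Fintype ι] [DecidableEq ι] (f : κ → ι)
    {W : κ → Type u} [∀ j, NormedAddCommGroup (W j)] [∀ j, InnerProductSpace ℂ (W j)]
    {M : ι → Type u} [∀ μ, NormedAddCommGroup (M μ)] [∀ μ, InnerProductSpace ℂ (M μ)]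
    (u : ∀ (μ : ι) (j : {j // f j = μ}), W j.1 ≃ₗᵢ[ℂ] M μ) :
    PiLp 2 W →ₗ[ℂ] PiLp 2 (fun μ => M μ ⊗[ℂ] EuclideanSpace ℂ {j // f j = μ}) where
  toFun y := WithLp.toLp 2 fun μ =>
    ∑ j, u μ j (y j.1) ⊗ₜ[ℂ] EuclideanSpace.basisFun {j // f j = μ} ℂ j
  map_add' x y := by
    ext μ
    simp only [PiLp.add_apply, map_add, TensorProduct.add_tmul, Finset.sum_add_distrib]
  map_smul' c x := by
    ext μ
    simp only [PiLp.smul_apply, map_smul, ← TensorProduct.smul_tmul', Finset.smul_sum,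
      RingHom.id_apply]

/-! ### Grouping identified summands into tensor products -/

section GroupFibers

variable {κ ι : Type u} [Fintype κ] [Fintype ι] [DecidableEq ι] (f : κ → ι)
  {W : κ → Type u} [∀ j, NormedAddCommGroup (W j)] [∀ j, InnerProductSpace ℂ (W j)]
  {M : ι → Type u} [∀ μ, NormedAddCommGroup (M μ)] [∀ μ, InnerProductSpace ℂ (M μ)]
  (u : ∀ (μ : ι) (j : {j // f j = μ}), W j.1 ≃ₗᵢ[ℂ] M μ)

theorem groupFibers_apply (y : PiLp 2 W) (μ : ι) :
    groupFibers f u y μ =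
      ∑ j, u μ j (y j.1) ⊗ₜ[ℂ] EuclideanSpace.basisFun {j // f j = μ} ℂ j := rfl

theorem norm_groupFibers (y : PiLp 2 W) : ‖groupFibers f u y‖ = ‖y‖ := by
  have h : ‖groupFibers f u y‖ ^ 2 = ‖y‖ ^ 2 := by
    rw [PiLp.norm_sq_eq_of_L2, PiLp.norm_sq_eq_of_L2]
    simp only [groupFibers_apply, norm_sum_tmul_orthonormalBasis_sq,
      LinearIsometryEquiv.norm_map]
    exact Fintype.sum_fiberwise f fun j => ‖y j‖ ^ 2
  exact (sq_eq_sq₀ (norm_nonneg _) (norm_nonneg _)).1 h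

variable [∀ j, FiniteDimensional ℂ (W j)] [∀ μ, FiniteDimensional ℂ (M μ)]

/-- The map `groupFibers` as a unitary. -/
def groupFibersIsometry :
    PiLp 2 W ≃ₗᵢ[ℂ] PiLp 2 (fun μ => M μ ⊗[ℂ] EuclideanSpace ℂ {j // f j = μ}) :=
  LinearIsometry.toLinearIsometryEquiv ⟨groupFibers f u, norm_groupFibers f u⟩
    (by
      -- An isometry is onto once dimensions agree: each fibre contributes its cardinality times
      -- `dim (M μ)` on both sides.
      rw [(WithLp.linearEquiv 2 ℂ (∀ j, W j)).finrank_eq,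
        (WithLp.linearEquiv 2 ℂ (∀ μ, M μ ⊗[ℂ] EuclideanSpace ℂ {j // f j = μ})).finrank_eq,
        Module.finrank_pi_fintype, Module.finrank_pi_fintype, ← Fintype.sum_fiberwise f]
      refine Finset.sum_congr rfl fun μ _ => ?_
      rw [Module.finrank_tensorProduct, finrank_euclideanSpace,
        Finset.sum_congr rfl fun j _ => (u μ j).toLinearEquiv.finrank_eq]
      simp [mul_comm])

theorem groupFibersIsometry_apply (y : PiLp 2 W) (μ : ι) :
    groupFibersIsometry f u y μ =
      ∑ j, u μ j (y j.1) ⊗ₜ[ℂ] EuclideanSpace.basisFun {j // f j = μ} ℂ j := rfl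

end GroupFibers

/-- Every finite-dimensional unitary representation decomposes into irreps. -/
theorem nonempty_irrepDecomposition [FiniteDimensional ℂ H] (U : G →* (H ≃ₗᵢ[ℂ] H)) :
    Nonempty (IrrepDecomposition U) := by
  classical
  obtain ⟨s, hs, hpair, hsup⟩ :=
    IsInvariantSubspace.exists_finset_sup_eq (U := U) (W := ⊤) (fun _ _ _ => trivial)
  let R : ∀ A : s, G →* (A.1 ≃ₗᵢ[ℂ] A.1) := fun A =>
    restrictUnitaryRep U A.1 (hs A.1 A.2).invariant
  have hR : ∀ A, (unitaryRepToRepresentation (R A)).IsIrreducible := fun A =>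
    (hs A.1 A.2).isIrreducible
  have horth : OrthogonalFamily ℂ (fun A : s => A.1) fun A => A.1.subtypeₗᵢ :=
    OrthogonalFamily.of_pairwise fun A B hAB =>
      hpair A.2 B.2 fun h => hAB (Subtype.ext h)
  have hint : DirectSum.IsInternal fun A : s => A.1 := by
    rw [horth.isInternal_iff]
    have : (⨆ A : s, A.1) = ⊤ := by
      rw [← hsup, Finset.sup_eq_iSup, iSup_subtype]; rfl
    rw [this, Submodule.top_orthogonal_eq_bot]
  let Ψ := hint.isometryL2OfOrthogonalFamily horth
  have hΨ : ∀ g x A, Ψ (U g x) A = R A g (Ψ x A) := by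
    intro g x A
    have h : Ψ.symm (WithLp.toLp 2 fun A => R A g (Ψ x A)) = U g x := by
      rw [hint.isometryL2OfOrthogonalFamily_symm_apply horth]
      conv_rhs => rw [← Ψ.symm_apply_apply x,
        hint.isometryL2OfOrthogonalFamily_symm_apply horth, map_sum]
      rfl
    rw [← h, LinearIsometryEquiv.apply_symm_apply]
  -- Classes are taken for unitary equivalence, so that members of a class can be identified
  -- isometrically with a representative. Distinct classes are still linearly inequivalent by
  -- `exists_isUnitaryIntertwiner_of_equiv`.
  let equivalent : Setoid s :=
    { r := fun A B => ∃ e : A.1 ≃ₗᵢ[ℂ] B.1, IsUnitaryIntertwiner (R A) (R B) e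
      iseqv :=
        { refl := fun A => ⟨.refl ℂ _, fun _ _ => rfl⟩
          symm := fun ⟨e, he⟩ => ⟨e.symm, fun g x => by
            rw [LinearIsometryEquiv.symm_apply_eq, he, LinearIsometryEquiv.apply_symm_apply]⟩
          trans := fun ⟨e, he⟩ ⟨f, hf⟩ => ⟨e.trans f, fun g x => by
            simp only [LinearIsometryEquiv.trans_apply]
            rw [he, hf]⟩ } }
  have hu : ∀ (μ : Quotient equivalent) (j : {A : s // (⟦A⟧ : Quotient equivalent) = μ}),
      ∃ e : j.1.1 ≃ₗᵢ[ℂ] μ.out.1, IsUnitaryIntertwiner (R j.1) (R μ.out) e := fun μ j =>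
    Quotient.exact (j.2.trans μ.out_eq.symm)
  choose u hu using hu
  let Φ := groupFibersIsometry (fun A : s => (⟦A⟧ : Quotient equivalent))
    (W := fun A : s => A.1) (M := fun μ : Quotient equivalent => μ.out.1) u
  exact ⟨{
    ι := Quotient equivalent
    M := fun μ => μ.out.1
    N := fun μ => EuclideanSpace ℂ {A : s // (⟦A⟧ : Quotient equivalent) = μ}
    irrep := fun μ => R μ.out
    irreducible := fun μ => hR _
    inequivalent := fun μ ν hμν => ⟨fun φ => hμν (by
      rw [← μ.out_eq, ← ν.out_eq]
      exact Quotient.sound (exists_isUnitaryIntertwiner_of_equiv _ _ (hR _) φ))⟩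
    iso := Ψ.trans Φ
    iso_apply := fun g x μ => by
      change Φ (Ψ (U g x)) μ = TensorProduct.map _ _ (Φ (Ψ x) μ)
      rw [groupFibersIsometry_apply, groupFibersIsometry_apply]
      rw [map_sum]
      refine Finset.sum_congr rfl fun j _ => ?_
      rw [hΨ, hu μ j]
      rfl }⟩

end Existence

end

theorem mainTheorem8 {G : Type v} [Group G] {H : Type u} [NormedAddCommGroup H]
    [InnerProductSpace ℂ H] [FiniteDimensional ℂ H] (U : G →* (H ≃ₗᵢ[ℂ] H)) :
    Nonempty (IrrepDecomposition U) ∧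
    ∀ (D : IrrepDecomposition U) (ψ₁ ψ₂ : H), ‖ψ₁‖ = 1 → ‖ψ₂‖ = 1 →
      ∃ V : H ≃ₗᵢ[ℂ] H, IsGInvariantUnitary U V ∧
        1 - 1 / 2 * ∑ μ, traceNorm (D.reduction (pureState ψ₁) μ - D.reduction (pureState ψ₂) μ)
          ≤ ‖inner ℂ ψ₂ (V ψ₁)‖ := by
  exact ⟨nonempty_irrepDecomposition U, fun D ψ₁ ψ₂ h₁ h₂ =>
    D.exists_isGInvariantUnitary_le_norm_inner ψ₁ ψ₂ h₁ h₂⟩
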